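/- **Model.** There are $n$ players and a set $M$ of $m$ indivisible items. A valuation is a monotone function $v:2^M\to\mathbb R_{\ge 0}$ with $v(\emptyset)=0$ and $v(M)>0$; it is submodular if $v(T\cup\{g\})-v(T)\le v(S\cup\{g\})-v(S)$ whenever $S\subseteq T\subseteq M$ and $g\in M$. An allocation is a partition $(A_1,\dots,A_n)$ of $M$ into labelled, possibly empty bundles; for $c\in[0,1]$ it is $c$-Prop if $v_i(A_i)\ge c\,v_i(M)/n$ for every player $i$. Player $i$ knows only $v_i$. In a protocol the players send bits seen by all players; who speaks depends on the messages so far, and each bit depends on these and on the speaker's valuation; the protocol ends when a player declares the answer (the declaration is not charged). In a public-coin randomized protocol the players moreover all see infinite streams of independent fair random bits, on which everything may depend. Such a protocol is correct if on every tuple of valuations of the given class its answer is right with probability at least $2/3$; its cost is the maximum number of bits sent, over all such tuples and all coins. Let $R_{submod}(n,m,\mathrm{Prop},c)$ be the minimum cost of a correct randomized protocol that, for $n$ players with submodular valuations on $m$ items, either finds a $c$-Prop allocation or reports that none exists, and let $R^{dec}_{submod}(n,m,\mathrm{Prop},c)$ be the minimum cost of a correct randomized protocol that only decides whether a $c$-Prop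 allocation exists. **Theorem.** For any $n>2$ and any $c$ with $0<c\le 1$, any randomized protocol which determines whether a $c$-Prop allocation exists requires an exponential amount of communication, even for submodular valuations. Specifically, $$R^{dec}_{submod}(n,2k+n-2,\mathrm{Prop},c)\in\Omega\!\left(\binom{2k}{k}\right),\qquad R_{submod}(n,2k+n-2,\mathrm{Prop},c)\in\Omega\!\left(\binom{2k}{k}\right):$$ there are an absolute constant $C>0$ and an absolute $K$ such that both quantities are at least $C\binom{2k}{k}$ for all $n>2$, all $0<c\le1$ and all $k\ge K$. The same bound holds for the decision problem when only players $1$ and $2$ have private valuations: for all such $n,c,k$, with $m=2k+n-2$, there are a set $L\subset\mathbb R$ of at most $m$ numbers and publicly known valuations of players $3,\dots,n$ for which any randomized protocol that is correct whenever the valuations of all players are submodular and have all their values in $L$ has cost at least $C\binom{2k}{k}$ on these inputs. -/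

import Mathlib

open scoped ENNReal NNReal

noncomputable section

namespace FairDivision

/-! ### Fair division -/

/-- A valuation on the bundles of a set of `m` items: nonnegative, monotone, normalized, and
giving the set of all items a positive value. -/
structure Valuation (m : ℕ) where
  val : Finset (Fin m) → ℝ
  nonneg : ∀ S, 0 ≤ val S
  mono : ∀ S T, S ⊆ T → val S ≤ val T
  normalized : val ∅ = 0
  total_pos : 0 < val Finset.univ

/-- Diminishing marginal values. -/
def Valuation.Submodular {m : ℕ} (v : Valuation m) : Prop :=
  ∀ (S T : Finset (Fin m)) (g : Fin m), S ⊆ T →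
    v.val (insert g T) - v.val T ≤ v.val (insert g S) - v.val S

/-- An allocation of `m` items to `n` players (a partition of the items into `n` labelled, possibly
empty bundles), given by the owner of each item. -/
abbrev Allocation (n m : ℕ) : Type := Fin m → Fin n

/-- The bundle that player `i` receives. -/
def Allocation.bundle {n m : ℕ} (A : Allocation n m) (i : Fin n) : Finset (Fin m) :=
  Finset.univ.filter fun g => A g = i

/-- The allocation `A` is `c`-Prop: each player gets at least `c / n` times her value for the
set of all items. -/
def IsProp {n m : ℕ} (c : ℝ) (v : Fin n → Valuation m) (A : Allocation n m) : Prop :=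
  ∀ i, c * ((v i).val Finset.univ / n) ≤ (v i).val (A.bundle i)

/-- `PropSearch c v o`: the answer `o` is right for the search problem, that is, `o` is a `c`-Prop
allocation, or `o` is `none` and there is no such allocation. -/
def PropSearch {n m : ℕ} (c : ℝ) (v : Fin n → Valuation m) : Option (Allocation n m) → Prop
  | some A => IsProp c v A
  | none => ¬ ∃ A : Allocation n m, IsProp c v A

/-- `PropDecision c v b`: the answer `b` is right for the problem of deciding whether a `c`-Prop
allocation exists. -/
def PropDecision {n m : ℕ} (c : ℝ) (v : Fin n → Valuation m) (b : Bool) : Prop :=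
  b = true ↔ ∃ A : Allocation n m, IsProp c v A

/-! ### Communication complexity -/

/-- A deterministic `n`-party protocol; each player holds a private input in `X`, the answer is in
`O`, and all messages are seen by all players. The position in the tree is the history of messages.
At a node `speak i f next`, player `i` sends one bit computed from her own input. At a leaf
`declare i f`, player `i` ends the protocol with an answer computed from her own input; the
declaration itself is not charged. -/
inductive Protocol (n : ℕ) (X O : Type) : Type
  | declare (i : Fin n) (f : X → O) : Protocol n X O
  | speak (i : Fin n) (f : X → Bool) (next : Bool → Protocol n X O) : Protocol n X O

namespace Protocol

variable {n : ℕ} {X O : Type}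

/-- The answer declared on the inputs `x`. -/
def answer : Protocol n X O → (Fin n → X) → O
  | declare i f, x => f (x i)
  | speak i f next, x => (next (f (x i))).answer x

/-- The number of bits sent on the inputs `x`. -/
def bits : Protocol n X O → (Fin n → X) → ℕ
  | declare _ _, _ => 0
  | speak i f next, x => (next (f (x i))).bits x + 1

end Protocol

/-- An infinite stream of bits for each of the `n` players. -/
abbrev Coins (n : ℕ) : Type := Fin n × ℕ → Bool

/-- The law of independent fair bits. -/
def coinMeasure (n : ℕ) : MeasureTheory.Measure (Coins n) :=
  MeasureTheory.Measure.infinitePi fun _ => (PMF.uniformOfFintype Bool).toMeasure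

/-- A public-coin randomized protocol: all players see the coins, so that these determine a
deterministic protocol. On each input the answer is required to be a random variable (used for
countable `O`). -/
structure RandProtocol (n : ℕ) (X O : Type) where
  det : Coins n → Protocol n X O
  measurable_answer : ∀ (x : Fin n → X) (o : O), MeasurableSet {ω | (det ω).answer x = o}

namespace RandProtocol

variable {n : ℕ} {X O : Type}

/-- On all inputs with `x i ∈ D i`, the answer is right with probability at least `2 / 3`. -/
def Correct (Γ : RandProtocol n X O) (D : Fin n → Set X) (Right : (Fin n → X) → O → Prop) : Prop :=
  ∀ x : Fin n → X, (∀ i, x i ∈ D i) →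
    2 / 3 ≤ coinMeasure n {ω | Right x ((Γ.det ω).answer x)}

/-- The number of bits sent in the worst case over the inputs with `x i ∈ D i` and the coins. -/
def cost (Γ : RandProtocol n X O) (D : Fin n → Set X) : ℕ∞ :=
  ⨆ (x : Fin n → X) (_ : ∀ i, x i ∈ D i) (ω : Coins n), ((Γ.det ω).bits x : ℕ∞)

end RandProtocol

/-- The randomized communication complexity of a problem on the inputs with `x i ∈ D i`: the
minimum cost of a correct randomized protocol. -/
def randComplexity {n : ℕ} {X O : Type} (D : Fin n → Set X) (Right : (Fin n → X) → O → Prop) : ℕ∞ :=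
  ⨅ (Γ : RandProtocol n X O) (_ : Γ.Correct D Right), Γ.cost D

/-- The randomized complexity of finding a `c`-Prop allocation of `m` items to `n` players with
submodular valuations, or reporting that there is none. -/
def RSubmodProp (n m : ℕ) (c : ℝ) : ℕ∞ :=
  randComplexity (fun _ : Fin n => {v : Valuation m | v.Submodular}) (PropSearch c)

/-- The randomized complexity of deciding whether there is a `c`-Prop allocation of `m` items to
`n` players with submodular valuations. -/
def RSubmodPropDecision (n m : ℕ) (c : ℝ) : ℕ∞ :=
  randComplexity (fun _ : Fin n => {v : Valuation m | v.Submodular}) (PropDecision c)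

/-- The same decision problem when only the first two players have private valuations, those of
the other players being publicly known to be `w`, and all values lie in the set `L`. -/
def RSubmodPropDecisionPublic (n m : ℕ) (c : ℝ) (w : Fin n → Valuation m) (L : Finset ℝ) : ℕ∞ :=
  randComplexity
    (fun i : Fin n => {v : Valuation m |
      v.Submodular ∧ (∀ S, v.val S ∈ L) ∧ (2 ≤ (i : ℕ) → v = w i)})
    (PropDecision c)

end FairDivision

end

noncomputable section

namespace FairDivision

/-! ### Hellinger distances on the Boolean cube -/

section Cube

variable {κ : Type*} [Fintype κ] [DecidableEq κ]

/-! The decision problem contains set disjointness on N = C(2k,k) coordinates, one for each k-subset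
of the first 2k items. With V = 2kn/c the share to be reached is 2k. Each of the n - 2 other players
needs one particular extra item, so the first two can only split the 2k items. Each accepts a part
of them exactly when it has more than k items, or has k items and is favoured. Hence both must get k
items, and the split is good exactly when x and y are both true at the first player's bundle
(`exists_isProp_hardProfile_iff`).

It remains to show that disjointness costs Ω(N) bits. Draw a mask z and strings u, v uniformly; the
sets u ∧ z and v ∧ ¬z are always disjoint, and for fixed z all bits of u and v are independent. A
protocol sending at most B bits has at most 3^(B+1) padded transcripts. By `level_one_inequality`,
the squared Hellinger distances between transcript laws caused by fixing single bits sum to O(B) in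
normalized form (`sum_hellinger_update_le`). Averaging over z, at a typical coordinate both moves
(0,0) → (1,0) and (0,0) → (0,1) hardly change the law if B is small against N. Transcript classes
are rectangles, so cut-and-paste (`sum_sub_le_hellinger`) transfers this to (0,0) → (1,1). That move
makes disjoint sets intersect, and a correct protocol must then raise its acceptance probability by
at least 1/3. Hence N = O(B). -/

theorem two_mul_sum_cube (j : κ) (F : (κ → Bool) → ℝ) :
    2 * ∑ w, F w = ∑ w, (F (Function.update w j true) + F (Function.update w j false)) := by
  have hinv : Function.Involutive fun w : κ → Bool => Function.update w j (!w j) := by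
    intro w
    simp
  have h := Equiv.sum_comp hinv.toPerm F
  rw [two_mul]
  nth_rewrite 2 [← h]
  rw [← Finset.sum_add_distrib]
  refine Finset.sum_congr rfl fun w _ => ?_
  simp only [Function.Involutive.coe_toPerm]
  have hw : Function.update w j (w j) = w := Function.update_eq_self j w
  cases hj : w j
  · rw [hj] at hw
    rw [hw, Bool.not_false, add_comm]
  · rw [hj] at hw
    rw [hw, Bool.not_true]

/-- The sign `±1` of a bit. -/
def bitSign (b : Bool) : ℝ := if b then 1 else -1

/-- The sum factors over the coordinates, and cosh a ≤ exp(a²/2) bounds each factor. -/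
theorem sum_exp_linear_le (a : κ → ℝ) :
    ∑ w : κ → Bool, Real.exp (∑ j, a j * bitSign (w j)) ≤
      2 ^ Fintype.card κ * Real.exp ((∑ j, a j ^ 2) / 2) := by
  have h1 : ∑ w : κ → Bool, Real.exp (∑ j, a j * bitSign (w j)) =
      ∏ j, ∑ b : Bool, Real.exp (a j * bitSign b) := by
    rw [Finset.prod_univ_sum, Fintype.piFinset_univ]
    exact Finset.sum_congr rfl fun w _ => Real.exp_sum _ _
  have h2 : ∀ j, ∑ b : Bool, Real.exp (a j * bitSign b) ≤ 2 * Real.exp (a j ^ 2 / 2) := by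
    intro j
    have := Real.cosh_le_exp_half_sq (a j)
    rw [Real.cosh_eq] at this
    simp only [Fintype.sum_bool, bitSign, if_true, Bool.false_eq_true, if_false, mul_one, mul_neg]
    linarith
  rw [h1]
  calc ∏ j, ∑ b : Bool, Real.exp (a j * bitSign b)
      ≤ ∏ j, (2 * Real.exp (a j ^ 2 / 2)) :=
        Finset.prod_le_prod (fun j _ => Finset.sum_nonneg fun b _ => (Real.exp_pos _).le)
          fun j _ => h2 j
    _ = _ := by
        rw [Finset.prod_mul_distrib, ← Real.exp_sum, Finset.sum_div]
        simp

/-- The level-one inequality. -/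
theorem level_one_inequality (e : (κ → Bool) → ℝ) (h0 : ∀ w, 0 ≤ e w) (h1 : ∀ w, e w ≤ 1)
    (hD : 0 < ∑ w, e w) :
    ∑ j, (∑ w, e w * bitSign (w j)) ^ 2 ≤
      2 * (∑ w, e w) ^ 2 * Real.log (2 ^ Fintype.card κ / ∑ w, e w) := by
  set D := ∑ w, e w with hDdef
  set d : κ → ℝ := fun j => ∑ w, e w * bitSign (w j) with hd
  set a : κ → ℝ := fun j => d j / D with ha
  set s := ∑ j, a j ^ 2 with hs
  set l := Real.log (2 ^ Fintype.card κ / D) with hl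
  have hsum : ∑ w, e w * ∑ j, a j * bitSign (w j) = D * s := by
    simp_rw [Finset.mul_sum]
    rw [Finset.sum_comm, hs, Finset.mul_sum]
    refine Finset.sum_congr rfl fun j _ => ?_
    have : d j = D * a j := by rw [ha]; field_simp
    calc ∑ w, e w * (a j * bitSign (w j)) = a j * d j := by
          rw [hd, Finset.mul_sum]; exact Finset.sum_congr rfl fun w _ => by ring
      _ = D * a j ^ 2 := by rw [this]; ring
  -- For 0 ≤ e ≤ 1 and any c, e·y ≤ exp(y - c) + (c - 1)·e. The choice c = s/2 + l makes the
  -- exponential terms sum to at most D, by `sum_exp_linear_le`.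
  have hle : ∑ w, e w * ∑ j, a j * bitSign (w j) ≤
      ∑ w, (Real.exp (-(s / 2 + l)) * Real.exp (∑ j, a j * bitSign (w j)) +
        (s / 2 + l - 1) * e w) := by
    refine Finset.sum_le_sum fun w _ => ?_
    rw [← Real.exp_add]
    set y := ∑ j, a j * bitSign (w j)
    have h2 := Real.add_one_le_exp (-(s / 2 + l) + y)
    have h3 := Real.exp_pos (-(s / 2 + l) + y)
    nlinarith [mul_le_mul_of_nonneg_left h2 (h0 w), mul_le_mul_of_nonneg_right (h1 w) h3.le]
  rw [Finset.sum_add_distrib, ← Finset.mul_sum, ← Finset.mul_sum, hsum, ← hDdef] at hle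
  have hexp : Real.exp (-(s / 2 + l)) * ∑ w : κ → Bool, Real.exp (∑ j, a j * bitSign (w j)) ≤ D := by
    refine (mul_le_mul_of_nonneg_left (sum_exp_linear_le a) (Real.exp_pos _).le).trans ?_
    have hW : (0 : ℝ) < 2 ^ Fintype.card κ := by positivity
    rw [neg_add, Real.exp_add, Real.exp_neg l, hl, Real.exp_log (by positivity), ← hs]
    have : Real.exp (-(s / 2)) * Real.exp (s / 2) = 1 := by rw [← Real.exp_add]; simp
    apply le_of_eq
    calc Real.exp (-(s / 2)) * (2 ^ Fintype.card κ / D)⁻¹ *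
          (2 ^ Fintype.card κ * Real.exp (s / 2))
        = (Real.exp (-(s / 2)) * Real.exp (s / 2)) *
          ((2 ^ Fintype.card κ / D)⁻¹ * 2 ^ Fintype.card κ) := by ring
      _ = D := by rw [this]; field_simp
  have hfin : D * s ≤ D * (s / 2 + l) := by linarith
  have hs2 : s ≤ 2 * l := by
    have := le_of_mul_le_mul_left hfin hD
    linarith
  have hdd : ∑ j, d j ^ 2 = D ^ 2 * s := by
    rw [hs, Finset.mul_sum]
    refine Finset.sum_congr rfl fun j _ => ?_
    rw [ha]
    field_simp
  rw [hdd]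
  nlinarith [mul_le_mul_of_nonneg_left hs2 (sq_nonneg D)]

/-- This passes from Hellinger distances to squared differences, which the level-one inequality
controls. -/
theorem sq_sqrt_sub_sqrt_mul_add_le {p q : ℝ} (hp : 0 ≤ p) (hq : 0 ≤ q) :
    (√p - √q) ^ 2 * (p + q) ≤ (p - q) ^ 2 := by
  have h1 := Real.sq_sqrt hp
  have h2 := Real.sq_sqrt hq
  have h3 := Real.sqrt_nonneg p
  have h4 := Real.sqrt_nonneg q
  have h5 : (p - q) ^ 2 = (√p - √q) ^ 2 * (√p + √q) ^ 2 := by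
    rw [← mul_pow, ← h1, ← h2]
    simp only [Real.sqrt_sq h3, Real.sqrt_sq h4]
    ring
  rw [h5]
  refine mul_le_mul_of_nonneg_left ?_ (sq_nonneg _)
  nlinarith [mul_nonneg h3 h4]

variable {Λ : Type*} [Fintype Λ] [DecidableEq Λ]

theorem sum_ite_eq_fiber {α : Type*} [Fintype α] (φ : α → Λ) :
    ∑ t, ∑ w, (if φ w = t then (1 : ℝ) else 0) = Fintype.card α := by
  rw [Finset.sum_comm]
  simp

/-- The squared Hellinger distances between the laws of `φ` after fixing one bit to `1` or to `0`,
summed over the bits, are bounded by the logarithm of the number of values of `φ`. -/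
theorem sum_hellinger_update_le (φ : (κ → Bool) → Λ) :
    ∑ j, ∑ t, (√(∑ w, if φ (Function.update w j true) = t then (1 : ℝ) else 0) -
        √(∑ w, if φ (Function.update w j false) = t then (1 : ℝ) else 0)) ^ 2 ≤
      4 * 2 ^ Fintype.card κ * Real.log (Fintype.card Λ) := by
  set c : κ → Bool → Λ → ℝ := fun j b t =>
    ∑ w, if φ (Function.update w j b) = t then (1 : ℝ) else 0 with hc
  set D : Λ → ℝ := fun t => ∑ w, if φ w = t then (1 : ℝ) else 0 with hD
  set W : ℝ := 2 ^ Fintype.card κ with hW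
  have hWpos : 0 < W := by positivity
  have hc0 : ∀ j b t, 0 ≤ c j b t := fun j b t =>
    Finset.sum_nonneg fun w _ => by split_ifs <;> norm_num
  have hD0 : ∀ t, 0 ≤ D t := fun t => Finset.sum_nonneg fun w _ => by split_ifs <;> norm_num
  have hcD : ∀ j t, 2 * D t = c j true t + c j false t := by
    intro j t
    simp only [hD, hc]
    rw [two_mul_sum_cube j, Finset.sum_add_distrib]
  have hΛ : 0 < Fintype.card Λ := Fintype.card_pos_iff.2 ⟨φ fun _ => true⟩
  have hL : (0 : ℝ) < Fintype.card Λ := by exact_mod_cast hΛ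
  have hpt : ∀ t, ∑ j, (√(c j true t) - √(c j false t)) ^ 2 ≤
      4 * (D t * Real.log (Fintype.card Λ) + W / Fintype.card Λ - D t) := by
    intro t
    rcases (hD0 t).eq_or_lt with h | h
    · have hz : ∀ j, c j true t = 0 ∧ c j false t = 0 := by
        intro j
        have := hcD j t
        rw [← h] at this
        exact ⟨by linarith [hc0 j true t, hc0 j false t], by linarith [hc0 j true t, hc0 j false t]⟩
      have hsum : ∑ j, (√(c j true t) - √(c j false t)) ^ 2 = 0 :=
        Finset.sum_eq_zero fun j _ => by rw [(hz j).1, (hz j).2]; simp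
      rw [hsum, ← h]
      have : 0 < W / Fintype.card Λ := by positivity
      linarith
    · have hlev := level_one_inequality (fun w => if φ w = t then (1 : ℝ) else 0)
        (fun w => by split_ifs <;> norm_num) (fun w => by split_ifs <;> norm_num) h
      have hd : ∀ j, 2 * ∑ w, (if φ w = t then (1 : ℝ) else 0) * bitSign (w j) =
          c j true t - c j false t := by
        intro j
        rw [two_mul_sum_cube j, Finset.sum_add_distrib, sub_eq_add_neg]
        simp only [hc, Function.update_self, bitSign]
        rw [← Finset.sum_neg_distrib]
        simp
      have h1 : ∀ j, (√(c j true t) - √(c j false t)) ^ 2 * (2 * D t) ≤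
          4 * (∑ w, (if φ w = t then (1 : ℝ) else 0) * bitSign (w j)) ^ 2 := by
        intro j
        have := sq_sqrt_sub_sqrt_mul_add_le (hc0 j true t) (hc0 j false t)
        rw [← hd j, ← hcD j t] at this
        linarith
      have h2 := Finset.sum_le_sum fun j (_ : j ∈ Finset.univ) => h1 j
      rw [← Finset.sum_mul, ← Finset.mul_sum] at h2
      have h3 : (∑ j, (√(c j true t) - √(c j false t)) ^ 2) * (2 * D t) ≤
          (4 * (D t * Real.log (W / D t))) * (2 * D t) := by
        have : D t = ∑ w, if φ w = t then (1 : ℝ) else 0 := rfl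
        rw [← this] at hlev
        nlinarith
      have h4 := le_of_mul_le_mul_right h3 (by linarith)
      -- This tangent bound replaces concavity of entropy: its error terms W/|Λ| - D t cancel when
      -- summed over t.
      have h5 := Real.log_le_sub_one_of_pos (show 0 < W / (D t * Fintype.card Λ) by positivity)
      have h6 : Real.log (W / (D t * Fintype.card Λ)) =
          Real.log (W / D t) - Real.log (Fintype.card Λ) := by
        rw [← div_div, Real.log_div (by positivity) (by positivity)]
      rw [h6] at h5
      have h7 := mul_le_mul_of_nonneg_left h5 h.le
      have h8 : D t * (W / (D t * Fintype.card Λ) - 1) = W / Fintype.card Λ - D t := by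
        field_simp
      rw [h8] at h7
      linarith
  rw [Finset.sum_comm]
  refine (Finset.sum_le_sum fun t _ => hpt t).trans ?_
  rw [← Finset.mul_sum, Finset.sum_sub_distrib, Finset.sum_add_distrib, ← Finset.sum_mul]
  have hDW : ∑ t, D t = W := by
    rw [hD, sum_ite_eq_fiber, hW]
    simp
  rw [hDW, Finset.sum_const, Finset.card_univ, nsmul_eq_mul, mul_div_cancel₀ _ hL.ne']
  linarith

end Cube

/-- The cut-and-paste property of Hellinger distances for families of product form. -/
theorem sum_sub_le_hellinger {Λ : Type*} [Fintype Λ] (α β : Bool → Λ → ℝ)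
    (hα : ∀ a t, 0 ≤ α a t) (hβ : ∀ b t, 0 ≤ β b t) (T : ℝ)
    (hT : ∀ a b, ∑ t, α a t * β b t = T) (G : Finset Λ) :
    ∑ t ∈ G, (α true t * β true t - α false t * β false t) ≤
      12 * (∑ t, (√(α true t * β false t) - √(α false t * β false t)) ^ 2 +
        ∑ t, (√(α false t * β true t) - √(α false t * β false t)) ^ 2) + T / 6 := by
  have hp : ∀ a b t, 0 ≤ α a t * β b t := fun a b t => mul_nonneg (hα a t) (hβ b t)
  have hsq : ∀ a b t, √(α a t * β b t) ^ 2 = α a t * β b t := fun a b t => Real.sq_sqrt (hp a b t)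
  have hcut : ∀ t, √(α true t * β true t) * √(α false t * β false t) =
      √(α true t * β false t) * √(α false t * β true t) := by
    intro t
    rw [← Real.sqrt_mul (hp _ _ _), ← Real.sqrt_mul (hp _ _ _)]
    congr 1
    ring
  -- Both sides are 2T minus twice a sum of cross terms, and `hcut` identifies the cross terms.
  have hH : ∑ t, (√(α true t * β true t) - √(α false t * β false t)) ^ 2 =
      ∑ t, (√(α true t * β false t) - √(α false t * β true t)) ^ 2 := by
    have h1 : ∀ t, (√(α true t * β true t) - √(α false t * β false t)) ^ 2 =
        (√(α true t * β false t) - √(α false t * β true t)) ^ 2 +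
        (α true t * β true t + α false t * β false t - α true t * β false t -
          α false t * β true t) := by
      intro t
      linear_combination hsq true true t + hsq false false t - hsq true false t -
        hsq false true t - 2 * hcut t
    simp_rw [h1]
    rw [Finset.sum_add_distrib, Finset.sum_sub_distrib, Finset.sum_sub_distrib,
      Finset.sum_add_distrib, hT, hT, hT, hT]
    ring
  calc ∑ t ∈ G, (α true t * β true t - α false t * β false t)
      ≤ ∑ t ∈ G, (6 * (√(α true t * β true t) - √(α false t * β false t)) ^ 2 +
          (α true t * β true t + α false t * β false t) / 12) := by
        refine Finset.sum_le_sum fun t _ => ?_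
        have h1 := hsq true true t
        have h2 := hsq false false t
        set p := √(α true t * β true t)
        set q := √(α false t * β false t)
        rw [← h1, ← h2]
        -- (p - q)(p + q) ≤ 6(p - q)² + (p + q)²/24, and (p + q)² ≤ 2(p² + q²). The weights leave an
        -- error T/6, half of the gap T/3 that correctness forces.
        nlinarith [sq_nonneg (12 * (p - q) - (p + q)), sq_nonneg (p - q)]
    _ ≤ ∑ t, (6 * (√(α true t * β true t) - √(α false t * β false t)) ^ 2 +
          (α true t * β true t + α false t * β false t) / 12) := by
        refine Finset.sum_le_sum_of_subset_of_nonneg (Finset.subset_univ _) fun t _ _ => ?_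
        have := hp true true t
        have := hp false false t
        positivity
    _ = 6 * ∑ t, (√(α true t * β false t) - √(α false t * β true t)) ^ 2 + T / 6 := by
        rw [Finset.sum_add_distrib, ← Finset.mul_sum, hH, ← Finset.sum_div,
          Finset.sum_add_distrib, hT, hT]
        ring
    _ ≤ _ := by
        have : ∑ t, (√(α true t * β false t) - √(α false t * β true t)) ^ 2 ≤
            ∑ t, (2 * (√(α true t * β false t) - √(α false t * β false t)) ^ 2 +
              2 * (√(α false t * β true t) - √(α false t * β false t)) ^ 2) := by
          refine Finset.sum_le_sum fun t _ => ?_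
          set p := √(α true t * β false t)
          set q := √(α false t * β true t)
          set r := √(α false t * β false t)
          nlinarith [sq_nonneg (p + q - 2 * r)]
        rw [Finset.sum_add_distrib, ← Finset.mul_sum, ← Finset.mul_sum] at this
        linarith

/-! ### Unique disjointness -/

section Disjointness

variable {ι : Type*} [DecidableEq ι]

/-- The set with characteristic vector `u`, restricted to `z`, with the bit `i` replaced by `b`. -/
def maskUpdate (z u : ι → Bool) (i : ι) (b : Bool) : ι → Bool :=
  Function.update (fun j => u j && z j) i b

theorem maskUpdate_self (z u : ι → Bool) (i : ι) (b : Bool) : maskUpdate z u i b i = b := by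
  simp [maskUpdate]

/-- The two masks are complementary, so the sets can meet only at the overwritten coordinate. -/
theorem not_maskUpdate_and (z u v : ι → Bool) (i j : ι) (h : j ≠ i) (a b : Bool) :
    ¬ (maskUpdate z u i a j = true ∧ maskUpdate (fun j => !z j) v i b j = true) := by
  simp only [maskUpdate, Function.update_of_ne h, Bool.and_eq_true, Bool.not_eq_true']
  rintro ⟨⟨-, h1⟩, -, h2⟩
  simp [h1] at h2

theorem maskUpdate_update (z u : ι → Bool) (i : ι) (a b : Bool) :
    maskUpdate (Function.update z i a) u i b = maskUpdate z u i b := by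
  funext j
  rcases eq_or_ne j i with rfl | h
  · simp [maskUpdate]
  · simp [maskUpdate, h]

theorem not_update (z : ι → Bool) (i : ι) (a : Bool) :
    (fun j => !Function.update z i a j) = Function.update (fun j => !z j) i (!a) := by
  funext j
  rcases eq_or_ne j i with rfl | h
  · simp
  · simp [h]

theorem update_and_of_true {z : ι → Bool} {i : ι} (hz : z i = true) (u : ι → Bool) (b : Bool) :
    (fun j => Function.update u i b j && z j) = maskUpdate z u i b := by
  funext j
  rcases eq_or_ne j i with rfl | h
  · simp [maskUpdate, hz]
  · simp [maskUpdate, h]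

theorem and_eq_maskUpdate_of_false {z : ι → Bool} {i : ι} (hz : z i = false) (u : ι → Bool) :
    (fun j => u j && z j) = maskUpdate z u i false := by
  funext j
  rcases eq_or_ne j i with rfl | h
  · simp [maskUpdate, hz]
  · simp [maskUpdate, h]

variable [Fintype ι] {Λ : Type*} [DecidableEq Λ]

/-- The number of pairs `u`, `v` for which the masked inputs, with the bits `i` replaced by `a` and
`b`, lead to the leaf `t`. -/
def leafCount (τ : (ι → Bool) → (ι → Bool) → Λ) (z : ι → Bool) (i : ι) (a b : Bool) (t : Λ) : ℝ :=
  ∑ p : (ι → Bool) × (ι → Bool),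
    if τ (maskUpdate z p.1 i a) (maskUpdate (fun j => !z j) p.2 i b) = t then 1 else 0

/-- The bit `z i` is overwritten on both sides. This independence lets an average over `z i` see
both one-sided moves at `i`. -/
theorem leafCount_update (τ : (ι → Bool) → (ι → Bool) → Λ) (z : ι → Bool) (i : ι) (c a b : Bool) :
    leafCount τ (Function.update z i c) i a b = leafCount τ z i a b := by
  funext t
  simp only [leafCount, maskUpdate_update, not_update]

variable [Fintype Λ]

/-- The squared Hellinger distance between two families of counts. -/
def hellingerSq (p q : Λ → ℝ) : ℝ := ∑ t, (√(p t) - √(q t)) ^ 2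

/-- Apply `sum_hellinger_update_le` to the joint string of u and v. At each coordinate the mask
leaves one of the two bits visible and sets the other input to 0; the nonnegative terms of the
hidden bits are dropped. -/
theorem sum_hellingerSq_le (τ : (ι → Bool) → (ι → Bool) → Λ) (z : ι → Bool) :
    ∑ i, (if z i = true then hellingerSq (leafCount τ z i true false) (leafCount τ z i false false)
        else hellingerSq (leafCount τ z i false true) (leafCount τ z i false false)) ≤
      4 * (2 ^ Fintype.card ι) ^ 2 * Real.log (Fintype.card Λ) := by
  let φ : (ι ⊕ ι → Bool) → Λ := fun w =>
    τ (fun j => w (Sum.inl j) && z j) (fun j => w (Sum.inr j) && !z j)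
  have h := sum_hellinger_update_le φ
  have hl : ∀ i, z i = true → ∀ b t, (∑ w, if φ (Function.update w (Sum.inl i) b) = t
      then (1 : ℝ) else 0) = leafCount τ z i b false t := by
    intro i hz b t
    rw [leafCount, ← Equiv.sum_comp (Equiv.sumArrowEquivProdArrow ι ι Bool)]
    refine Finset.sum_congr rfl fun w _ => ?_
    congr 2
    simp only [φ]
    congr 1
    · rw [← update_and_of_true hz]
      funext j
      rcases eq_or_ne j i with rfl | hj
      · simp
      · simp [hj, Equiv.sumArrowEquivProdArrow]
    · rw [← and_eq_maskUpdate_of_false (by simp [hz])]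
      funext j
      simp [Equiv.sumArrowEquivProdArrow]
  have hr : ∀ i, z i ≠ true → ∀ b t, (∑ w, if φ (Function.update w (Sum.inr i) b) = t
      then (1 : ℝ) else 0) = leafCount τ z i false b t := by
    intro i hz b t
    replace hz : z i = false := by simpa using hz
    rw [leafCount, ← Equiv.sum_comp (Equiv.sumArrowEquivProdArrow ι ι Bool)]
    refine Finset.sum_congr rfl fun w _ => ?_
    congr 2
    simp only [φ]
    congr 1
    · rw [← and_eq_maskUpdate_of_false hz]
      funext j
      simp [Equiv.sumArrowEquivProdArrow]
    · rw [← update_and_of_true (z := fun j => !z j) (by simp [hz])]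
      funext j
      rcases eq_or_ne j i with rfl | hj
      · simp
      · simp [hj, Equiv.sumArrowEquivProdArrow]
  rw [Fintype.sum_sum_type, ← Finset.sum_add_distrib, Fintype.card_sum, pow_add, ← sq] at h
  refine (Finset.sum_le_sum fun i _ => ?_).trans h
  split_ifs with hz
  · simp_rw [hl i hz]
    exact le_add_of_nonneg_right (Finset.sum_nonneg fun _ _ => sq_nonneg _)
  · simp_rw [hr i hz]
    exact le_add_of_nonneg_left (Finset.sum_nonneg fun _ _ => sq_nonneg _)

/-- Since the leaves are rectangles, each count is a product of a number of u and a number of v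
compatible with the leaf, so cut-and-paste applies. -/
theorem sum_leafCount_sub_le (τ : (ι → Bool) → (ι → Bool) → Λ)
    (hτ : ∀ x y x' y', τ x y = τ x' y' → τ x y' = τ x y) (G : Finset Λ) (z : ι → Bool) (i : ι) :
    ∑ t ∈ G, (leafCount τ z i true true t - leafCount τ z i false false t) ≤
      12 * (hellingerSq (leafCount τ z i true false) (leafCount τ z i false false) +
        hellingerSq (leafCount τ z i false true) (leafCount τ z i false false)) +
      (2 ^ Fintype.card ι) ^ 2 / 6 := by
  classical
  let α : Bool → Λ → ℝ := fun a t =>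
    ∑ u, if ∃ y, τ (maskUpdate z u i a) y = t then 1 else 0
  let β : Bool → Λ → ℝ := fun b t =>
    ∑ v, if ∃ x, τ x (maskUpdate (fun j => !z j) v i b) = t then 1 else 0
  have hprod : ∀ a b t, leafCount τ z i a b t = α a t * β b t := by
    intro a b t
    simp only [leafCount, α, β, Finset.sum_mul_sum, Fintype.sum_prod_type]
    refine Finset.sum_congr rfl fun u _ => Finset.sum_congr rfl fun v _ => ?_
    rw [ite_zero_mul_ite_zero, mul_one]
    refine if_congr ⟨fun h => ⟨⟨_, h⟩, ⟨_, h⟩⟩, ?_⟩ rfl rfl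
    rintro ⟨⟨y, hy⟩, ⟨x, hx⟩⟩
    rw [hτ _ _ _ _ (hy.trans hx.symm), hy]
  have hT : ∀ a b, ∑ t, α a t * β b t = (2 ^ Fintype.card ι) ^ 2 := by
    intro a b
    simp_rw [← hprod, leafCount]
    rw [sum_ite_eq_fiber]
    simp [sq]
  have := sum_sub_le_hellinger α β
    (fun a t => Finset.sum_nonneg fun _ _ => by split_ifs <;> norm_num)
    (fun a t => Finset.sum_nonneg fun _ _ => by split_ifs <;> norm_num) _ hT G
  simpa only [hellingerSq, hprod] using this

/-- A function that is constant on the parts of a partition into rectangles can hardly tell disjoint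
sets from sets that have one element in common, unless there are many parts. -/
theorem sum_leaf_intersecting_sub_disjoint_le (τ : (ι → Bool) → (ι → Bool) → Λ)
    (hτ : ∀ x y x' y', τ x y = τ x' y' → τ x y' = τ x y) (G : Finset Λ) :
    ∑ i, ∑ z, ∑ p : (ι → Bool) × (ι → Bool),
      ((if τ (maskUpdate z p.1 i true) (maskUpdate (fun j => !z j) p.2 i true) ∈ G
          then (1 : ℝ) else 0) -
        (if τ (maskUpdate z p.1 i false) (maskUpdate (fun j => !z j) p.2 i false) ∈ G
          then (1 : ℝ) else 0)) ≤
      (2 ^ Fintype.card ι) ^ 3 *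
        (Fintype.card ι / 6 + 96 * Real.log (Fintype.card Λ)) := by
  set W : ℝ := 2 ^ Fintype.card ι with hW
  have hcount : ∀ z i a, ∑ p : (ι → Bool) × (ι → Bool),
      (if τ (maskUpdate z p.1 i a) (maskUpdate (fun j => !z j) p.2 i a) ∈ G
          then (1 : ℝ) else 0) = ∑ t ∈ G, leafCount τ z i a a t := by
    intro z i a
    simp only [leafCount]
    rw [Finset.sum_comm]
    refine Finset.sum_congr rfl fun p _ => ?_
    rw [Finset.sum_ite_eq]
  have hcard : ∑ _z : ι → Bool, (1 : ℝ) = W := by simp [hW]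
  set H1 : ι → (ι → Bool) → ℝ := fun i z =>
    hellingerSq (leafCount τ z i true false) (leafCount τ z i false false) with hH1
  set H2 : ι → (ι → Bool) → ℝ := fun i z =>
    hellingerSq (leafCount τ z i false true) (leafCount τ z i false false) with hH2
  -- For each `i`, half of the masks select H1 and half select H2, whence the factor 24 = 2 · 12.
  have hpt : ∀ i, ∑ z, (12 * (H1 i z + H2 i z) + W ^ 2 / 6) =
      24 * ∑ z, (if z i = true then H1 i z else H2 i z) + W ^ 3 / 6 := by
    intro i
    have h := two_mul_sum_cube i (fun z => if z i = true then H1 i z else H2 i z)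
    simp only [Function.update_self, if_true, Bool.false_eq_true, if_false, hH1, hH2,
      leafCount_update] at h
    rw [Finset.sum_add_distrib, ← Finset.mul_sum]
    have hc : ∑ _z : ι → Bool, W ^ 2 / 6 = W ^ 3 / 6 := by
      calc ∑ _z : ι → Bool, W ^ 2 / 6 = (∑ _z : ι → Bool, (1 : ℝ)) * (W ^ 2 / 6) := by
            rw [Finset.sum_mul]; simp
        _ = W ^ 3 / 6 := by rw [hcard]; ring
    rw [hc]
    simp only [hH1, hH2]
    linarith
  calc _ = ∑ i, ∑ z, ∑ t ∈ G, (leafCount τ z i true true t - leafCount τ z i false false t) := by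
        simp_rw [Finset.sum_sub_distrib, hcount]
    _ ≤ ∑ i, ∑ z, (12 * (H1 i z + H2 i z) + W ^ 2 / 6) :=
        Finset.sum_le_sum fun i _ => Finset.sum_le_sum fun z _ => sum_leafCount_sub_le τ hτ G z i
    _ = 24 * ∑ z, ∑ i, (if z i = true then H1 i z else H2 i z) +
          Fintype.card ι * (W ^ 3 / 6) := by
        simp_rw [hpt]
        rw [Finset.sum_add_distrib, ← Finset.mul_sum, Finset.sum_comm]
        simp
    _ ≤ 24 * ∑ z : ι → Bool, 4 * W ^ 2 * Real.log (Fintype.card Λ) +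
          Fintype.card ι * (W ^ 3 / 6) := by
        have := Finset.sum_le_sum fun z (_ : z ∈ Finset.univ) => sum_hellingerSq_le τ z
        simp only [hH1, hH2]
        linarith
    _ = _ := by
        have : ∑ z : ι → Bool, 4 * W ^ 2 * Real.log (Fintype.card Λ) =
            (∑ _z : ι → Bool, (1 : ℝ)) * (4 * W ^ 2 * Real.log (Fintype.card Λ)) := by
          rw [Finset.sum_mul]; simp
        rw [this, hcard]
        ring

end Disjointness

/-! ### Transcripts of protocols -/

namespace Protocol

variable {n : ℕ} {X : Type}

/-- The messages sent on the inputs `x`, followed by the answer. -/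
def transcript : Protocol n X Bool → (Fin n → X) → List Bool
  | declare i f, x => [f (x i)]
  | speak i f next, x => f (x i) :: (next (f (x i))).transcript x

theorem length_transcript (p : Protocol n X Bool) (x : Fin n → X) :
    (p.transcript x).length = p.bits x + 1 := by
  induction p with
  | declare i f => rfl
  | speak i f next ih => simp [transcript, bits, ih]

theorem getLast?_transcript (p : Protocol n X Bool) (x : Fin n → X) :
    (p.transcript x).getLast? = some (p.answer x) := by
  induction p with
  | declare i f => rfl
  | speak i f next ih => simp [transcript, answer, List.getLast?_cons, ih]

/-- Every message depends on one player's input, which `z` shares with one of two runs that agree on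
all messages. This is the source of the rectangle property. -/
theorem transcript_mix (p : Protocol n X Bool) {x y z : Fin n → X}
    (hz : ∀ i, z i = x i ∨ z i = y i) (h : p.transcript x = p.transcript y) :
    p.transcript z = p.transcript x := by
  induction p with
  | declare i f =>
    simp only [transcript, List.cons.injEq, and_true] at h ⊢
    rcases hz i with e | e <;> rw [e]
    exact h.symm
  | speak i f next ih =>
    simp only [transcript, List.cons.injEq] at h ⊢
    have hf : f (z i) = f (x i) := by
      rcases hz i with e | e <;> rw [e]
      exact h.1.symm
    refine ⟨hf, ?_⟩
    rw [hf]
    exact ih _ (by rw [h.2, h.1])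

/-- Change the answer of a protocol by a function of it. -/
def mapAnswer {O P : Type} (g : O → P) : Protocol n X O → Protocol n X P
  | declare i f => declare i (g ∘ f)
  | speak i f next => speak i f fun b => (next b).mapAnswer g

theorem answer_mapAnswer {O P : Type} (g : O → P) (p : Protocol n X O) (x : Fin n → X) :
    (p.mapAnswer g).answer x = g (p.answer x) := by
  induction p with
  | declare i f => rfl
  | speak i f next ih => simp [mapAnswer, answer, ih]

theorem bits_mapAnswer {O P : Type} (g : O → P) (p : Protocol n X O) (x : Fin n → X) :
    (p.mapAnswer g).bits x = p.bits x := by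
  induction p with
  | declare i f => rfl
  | speak i f next ih => simp [mapAnswer, bits, ih]

end Protocol

/-- A list of length at most `N` as a function on `Fin N`. -/
def paddedList (N : ℕ) (l : List Bool) : Fin N → Option Bool := fun i => l[(i : ℕ)]?

theorem paddedList_inj {N : ℕ} {l l' : List Bool} (hl : l.length ≤ N) (hl' : l'.length ≤ N)
    (h : paddedList N l = paddedList N l') : l = l' := by
  refine List.ext_getElem? fun i => ?_
  by_cases hi : i < N
  · exact congrFun h ⟨i, hi⟩
  · rw [List.getElem?_eq_none (by omega), List.getElem?_eq_none (by omega)]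

/-! ### Comparison of communication problems -/

theorem randComplexity_mono {n : ℕ} {X O : Type} {D D' : Fin n → Set X}
    (h : ∀ i, D i ⊆ D' i) (Right : (Fin n → X) → O → Prop) :
    randComplexity D Right ≤ randComplexity D' Right := by
  refine le_iInf₂ fun Γ hΓ => ?_
  refine (iInf₂_le Γ fun x hx => hΓ x fun i => h i (hx i)).trans ?_
  exact iSup_mono fun x => iSup_le fun hx => le_iSup_of_le (fun i => h i (hx i)) le_rfl

/-- Finiteness of `O` makes each event for the new answer a countable union of measurable ones. -/
theorem randComplexity_mapAnswer_le {n : ℕ} {X O P : Type} [Finite O] (D : Fin n → Set X)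
    (Right : (Fin n → X) → O → Prop) (Right' : (Fin n → X) → P → Prop) (g : O → P)
    (hg : ∀ x o, Right x o → Right' x (g o)) :
    randComplexity D Right' ≤ randComplexity D Right := by
  refine le_iInf₂ fun Γ hΓ => ?_
  let Γ' : RandProtocol n X P :=
    { det := fun ω => (Γ.det ω).mapAnswer g
      measurable_answer := fun x o => by
        have : {ω | ((Γ.det ω).mapAnswer g).answer x = o} =
            ⋃ q ∈ {q : O | g q = o}, {ω | (Γ.det ω).answer x = q} := by
          ext ω
          simp [Protocol.answer_mapAnswer]
        rw [this]
        exact MeasurableSet.biUnion (Set.to_countable _) fun q _ => Γ.measurable_answer x q }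
  have hΓ' : Γ'.Correct D Right' := fun x hx =>
    (hΓ x hx).trans (MeasureTheory.measure_mono fun ω hω => by
      simp only [Set.mem_ofPred_eq, Γ', Protocol.answer_mapAnswer] at hω ⊢
      exact hg x _ hω)
  refine (iInf₂_le Γ' hΓ').trans (le_of_eq ?_)
  simp only [RandProtocol.cost, Γ', Protocol.bits_mapAnswer]

theorem randComplexity_propDecision_le {n m : ℕ} (c : ℝ) (D : Fin n → Set (Valuation m)) :
    randComplexity D (PropDecision c) ≤ randComplexity D (PropSearch c) := by
  refine randComplexity_mapAnswer_le D _ _ Option.isSome fun v o ho => ?_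
  cases o with
  | none => simpa [PropDecision, PropSearch] using ho
  | some A => exact ⟨fun _ => ⟨A, ho⟩, fun _ => rfl⟩

/-! ### Hard valuations -/

/-- The items with an index below `r`. -/
def lowItems (m r : ℕ) : Finset (Fin m) := Finset.univ.filter fun g => (g : ℕ) < r

theorem mem_lowItems {m r : ℕ} {g : Fin m} : g ∈ lowItems m r ↔ (g : ℕ) < r := by
  simp [lowItems]

theorem card_lowItems {m r : ℕ} (h : r ≤ m) : (lowItems m r).card = r := by
  simp [lowItems, Fin.card_filter_val_lt, h]

/-- Twice the size of the bundle, capped at `2 * k`, with a loss of `1` for the bundles of size `k`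
that are not favoured. -/
def cappedVal {m : ℕ} (k : ℕ) (F : Finset (Fin m) → Prop) [DecidablePred F]
    (S : Finset (Fin m)) : ℝ :=
  if S.card < k then 2 * (S.card : ℝ)
  else if S.card = k ∧ ¬ F S then 2 * k - 1 else 2 * k

section Capped

variable {m k : ℕ} {F : Finset (Fin m) → Prop} [DecidablePred F]

theorem cappedVal_of_lt {S : Finset (Fin m)} (h : S.card < k) :
    cappedVal k F S = 2 * (S.card : ℝ) := by simp [cappedVal, h]

theorem cappedVal_of_gt {S : Finset (Fin m)} (h : k < S.card) : cappedVal k F S = 2 * k := by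
  simp [cappedVal, h.ne', h.not_gt]

theorem cappedVal_of_favoured {S : Finset (Fin m)} (h : S.card = k) (hF : F S) :
    cappedVal k F S = 2 * k := by simp [cappedVal, h, hF]

theorem cappedVal_of_not_favoured {S : Finset (Fin m)} (h : S.card = k) (hF : ¬ F S) :
    cappedVal k F S = 2 * k - 1 := by simp [cappedVal, h, hF]

theorem cappedVal_eq_of_card_eq {S : Finset (Fin m)} (h : S.card = k) :
    cappedVal k F S = 2 * k - 1 ∨ cappedVal k F S = 2 * k := by
  by_cases hF : F S
  · exact Or.inr (cappedVal_of_favoured h hF)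
  · exact Or.inl (cappedVal_of_not_favoured h hF)

theorem cappedVal_nonneg (hk : 0 < k) (S : Finset (Fin m)) : 0 ≤ cappedVal k F S := by
  have : (1 : ℝ) ≤ k := by exact_mod_cast hk
  unfold cappedVal
  split_ifs
  · positivity
  · linarith
  · linarith

theorem cappedVal_le (S : Finset (Fin m)) : cappedVal k F S ≤ 2 * k := by
  unfold cappedVal
  split_ifs with h
  · have : (S.card : ℝ) ≤ k := by exact_mod_cast h.le
    linarith
  · linarith
  · exact le_rfl

theorem cappedVal_mono {S T : Finset (Fin m)} (h : S ⊆ T) :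
    cappedVal k F S ≤ cappedVal k F T := by
  rcases (Finset.card_le_card h).eq_or_lt with hc | hc
  · rw [Finset.eq_of_subset_of_card_le h hc.ge]
  rcases lt_trichotomy T.card k with hT | hT | hT
  · rw [cappedVal_of_lt (hc.trans hT), cappedVal_of_lt hT]
    have : (S.card : ℝ) ≤ T.card := by exact_mod_cast hc.le
    linarith
  · rw [cappedVal_of_lt (hT ▸ hc)]
    have h1 : (S.card : ℝ) + 1 ≤ k := by exact_mod_cast (hT ▸ hc : S.card < k)
    rcases cappedVal_eq_of_card_eq (F := F) hT with e | e <;> rw [e] <;> linarith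
  · rw [cappedVal_of_gt hT]
    exact cappedVal_le S

/-- The marginal of a new item is 2 below size k - 1, is 1 or 2 at size k - 1, is 0 or 1 at size k,
and 0 above. Nested sets of equal size coincide, so the choice of `F` never matters. -/
theorem cappedVal_submodular {S T : Finset (Fin m)} (h : S ⊆ T) (g : Fin m) :
    cappedVal k F (insert g T) - cappedVal k F T ≤
      cappedVal k F (insert g S) - cappedVal k F S := by
  by_cases hg : g ∈ T
  · rw [Finset.insert_eq_of_mem hg, sub_self, sub_nonneg]
    exact cappedVal_mono (Finset.subset_insert g S)
  have hgS : g ∉ S := fun h' => hg (h h')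
  rcases (Finset.card_le_card h).eq_or_lt with hc | hc
  · rw [Finset.eq_of_subset_of_card_le h hc.ge]
  have hcT := Finset.card_insert_of_notMem hg
  have hcS := Finset.card_insert_of_notMem hgS
  have hcS' : ((insert g S).card : ℝ) = S.card + 1 := by exact_mod_cast hcS
  have hcT' : ((insert g T).card : ℝ) = T.card + 1 := by exact_mod_cast hcT
  rcases lt_trichotomy T.card k with hT | hT | hT
  · have h2 : cappedVal k F (insert g S) - cappedVal k F S = 2 := by
      rw [cappedVal_of_lt (hc.trans hT), cappedVal_of_lt (by omega), hcS']
      ring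
    rw [h2, cappedVal_of_lt hT]
    rcases lt_or_eq_of_le (show T.card + 1 ≤ k from hT) with h3 | h3
    · rw [cappedVal_of_lt (by omega), hcT']
      linarith
    · have := cappedVal_le (k := k) (F := F) (insert g T)
      have h4 : (T.card : ℝ) + 1 = k := by exact_mod_cast h3
      linarith
  · have h1 : cappedVal k F (insert g T) - cappedVal k F T ≤ 1 := by
      rw [cappedVal_of_gt (by omega)]
      rcases cappedVal_eq_of_card_eq (F := F) hT with e | e <;> rw [e] <;> linarith
    refine h1.trans ?_
    rw [cappedVal_of_lt (show S.card < k by omega)]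
    rcases lt_or_eq_of_le (show S.card + 1 ≤ k by omega) with h3 | h3
    · rw [cappedVal_of_lt (by omega), hcS']
      linarith
    · have h4 : (S.card : ℝ) + 1 = k := by exact_mod_cast h3
      rcases cappedVal_eq_of_card_eq (F := F) (show (insert g S).card = k by omega) with e | e <;>
        rw [e] <;> linarith
  · rw [cappedVal_of_gt hT, cappedVal_of_gt (by omega), sub_self, sub_nonneg]
    exact cappedVal_mono (Finset.subset_insert g S)

end Capped

/-- The valuation that is `V` on the bundles with an item outside of the first `2 * k`, and
`cappedVal` on the other bundles. -/
def hardValuation {m : ℕ} (k : ℕ) (F : Finset (Fin m) → Prop) [DecidablePred F] (V : ℝ)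
    (hk : 0 < k) (hm : 2 * k < m) (hV : 2 * k ≤ V) : Valuation m where
  val S := if S ⊆ lowItems m (2 * k) then cappedVal k F S else V
  nonneg S := by
    split_ifs
    · exact cappedVal_nonneg hk S
    · exact le_trans (by positivity) hV
  mono S T h := by
    split_ifs with h1 h2 h2
    · exact cappedVal_mono h
    · exact (cappedVal_le S).trans hV
    · exact absurd (h.trans h2) h1
    · exact le_rfl
  normalized := by simp [cappedVal, hk]
  total_pos := by
    have h : ¬ Finset.univ ⊆ lowItems m (2 * k) := fun h =>
      absurd (mem_lowItems.1 (h (Finset.mem_univ (⟨2 * k, hm⟩ : Fin m)))) (by simp)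
    rw [if_neg h]
    exact lt_of_lt_of_le (by positivity) hV

/-- An outside item raises the value to V, a gain that shrinks as the bundle grows; once V is
reached nothing more is gained. -/
theorem hardValuation_submodular {m k : ℕ} (F : Finset (Fin m) → Prop) [DecidablePred F] (V : ℝ)
    (hk : 0 < k) (hm : 2 * k < m) (hV : 2 * k ≤ V) :
    (hardValuation k F V hk hm hV).Submodular := by
  intro S T g h
  have hmono := (hardValuation k F V hk hm hV).mono S (insert g S) (Finset.subset_insert g S)
  simp only [hardValuation] at hmono ⊢
  by_cases hT : T ⊆ lowItems m (2 * k)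
  · by_cases hg : g ∈ lowItems m (2 * k)
    · have hS := h.trans hT
      rw [if_pos hT, if_pos hS, if_pos (Finset.insert_subset hg hT),
        if_pos (Finset.insert_subset hg hS)]
      exact cappedVal_submodular h g
    · have hi : ∀ U : Finset (Fin m), ¬ insert g U ⊆ lowItems m (2 * k) := fun U hU =>
        hg (hU (Finset.mem_insert_self g U))
      rw [if_neg (hi T), if_neg (hi S), if_pos hT, if_pos (h.trans hT)]
      linarith [cappedVal_mono (k := k) (F := F) h]
  · rw [if_neg hT, if_neg fun h' => hT ((Finset.subset_insert g T).trans h'), sub_self, sub_nonneg]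
    exact hmono

/-- The valuation that is `V` on the bundles with the item `g`, and `0` otherwise. -/
def singleItemValuation {m : ℕ} (g : Fin m) (V : ℝ) (hV : 0 < V) : Valuation m where
  val S := if g ∈ S then V else 0
  nonneg S := by split_ifs <;> linarith
  mono S T h := by
    split_ifs with h1 h2
    · exact le_rfl
    · exact absurd (h h1) h2
    · exact hV.le
    · exact le_rfl
  normalized := by simp
  total_pos := by simpa using hV

theorem singleItemValuation_submodular {m : ℕ} (g : Fin m) (V : ℝ) (hV : 0 < V) :
    (singleItemValuation g V hV).Submodular := by
  intro S T h hST
  simp only [singleItemValuation, Finset.mem_insert]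
  by_cases hgh : g = h
  · subst hgh
    by_cases h1 : g ∈ S
    · simp [h1, hST h1]
    · by_cases h2 : g ∈ T
      · simp [h1, h2, hV.le]
      · simp [h1, h2]
  · simp [hgh]

/-- The values of `hardValuation` and `singleItemValuation`. -/
def hardValues (k : ℕ) (V : ℝ) : Finset ℝ :=
  (Finset.range k).image (fun j : ℕ => 2 * (j : ℝ)) ∪ {2 * (k : ℝ) - 1, 2 * (k : ℝ), V}

theorem card_hardValues_le (k : ℕ) (V : ℝ) : (hardValues k V).card ≤ k + 3 :=
  (Finset.card_union_le _ _).trans <| add_le_add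
    (Finset.card_image_le.trans (Finset.card_range k).le) Finset.card_le_three

theorem hardValuation_val_mem {m k : ℕ} (F : Finset (Fin m) → Prop) [DecidablePred F] (V : ℝ)
    (hk : 0 < k) (hm : 2 * k < m) (hV : 2 * k ≤ V) (S : Finset (Fin m)) :
    (hardValuation k F V hk hm hV).val S ∈ hardValues k V := by
  simp only [hardValuation, cappedVal, hardValues, Finset.mem_union, Finset.mem_image,
    Finset.mem_range, Finset.mem_insert, Finset.mem_singleton]
  split_ifs with h1 h2
  · exact Or.inl ⟨S.card, h2, rfl⟩
  · simp
  · simp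
  · simp

theorem singleItemValuation_val_mem {m k : ℕ} (g : Fin m) (V : ℝ) (hV : 0 < V) (hk : 0 < k)
    (S : Finset (Fin m)) : (singleItemValuation g V hV).val S ∈ hardValues k V := by
  simp only [singleItemValuation, hardValues, Finset.mem_union, Finset.mem_image,
    Finset.mem_range, Finset.mem_insert, Finset.mem_singleton]
  split_ifs
  · simp
  · exact Or.inl ⟨0, hk, by simp⟩

/-! ### Protocols for unique disjointness -/

section ProtocolBound

variable {ι : Type*} [Fintype ι] [DecidableEq ι] {n : ℕ} {X : Type}

/-- The condition `hinp` holds as soon as each player's input depends on x alone or on y alone. -/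
theorem Protocol.sum_answer_intersecting_sub_disjoint_le
    (inp : (ι → Bool) → (ι → Bool) → Fin n → X)
    (hinp : ∀ x y x' y' i, inp x y' i = inp x y i ∨ inp x y' i = inp x' y' i)
    (p : Protocol n X Bool) (B : ℕ) (hB : ∀ x y, p.bits (inp x y) ≤ B) :
    ∑ i, ∑ z, ∑ q : (ι → Bool) × (ι → Bool),
      ((if p.answer (inp (maskUpdate z q.1 i true) (maskUpdate (fun j => !z j) q.2 i true)) = true
          then (1 : ℝ) else 0) -
        (if p.answer (inp (maskUpdate z q.1 i false)
          (maskUpdate (fun j => !z j) q.2 i false)) = true then (1 : ℝ) else 0)) ≤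
      (2 ^ Fintype.card ι) ^ 3 * (Fintype.card ι / 6 + 96 * ((B + 1) * Real.log 3)) := by
  classical
  -- Three symbols at B + 1 positions. The extra position records the uncharged answer, so
  -- acceptance is determined by the leaf.
  let τ : (ι → Bool) → (ι → Bool) → Fin (B + 1) → Option Bool := fun x y =>
    paddedList (B + 1) (p.transcript (inp x y))
  have hlen : ∀ x y, (p.transcript (inp x y)).length ≤ B + 1 := fun x y => by
    rw [p.length_transcript]
    exact Nat.succ_le_succ (hB x y)
  have htr : ∀ x y x' y', τ x y = τ x' y' →
      p.transcript (inp x y) = p.transcript (inp x' y') := fun x y x' y' h =>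
    paddedList_inj (hlen x y) (hlen x' y') h
  have hτ : ∀ x y x' y', τ x y = τ x' y' → τ x y' = τ x y := fun x y x' y' h =>
    congrArg (paddedList (B + 1)) (p.transcript_mix (hinp x y x' y') (htr _ _ _ _ h))
  let G : Finset (Fin (B + 1) → Option Bool) :=
    Finset.univ.filter fun t => ∃ x y, τ x y = t ∧ p.answer (inp x y) = true
  have hG : ∀ x y, p.answer (inp x y) = true ↔ τ x y ∈ G := by
    intro x y
    simp only [G, Finset.mem_filter, Finset.mem_univ, true_and]
    refine ⟨fun h => ⟨x, y, rfl, h⟩, ?_⟩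
    rintro ⟨x', y', h, h'⟩
    have h1 := p.getLast?_transcript (inp x y)
    rw [← htr _ _ _ _ h, p.getLast?_transcript, Option.some.injEq] at h1
    rw [← h1, h']
  have h := sum_leaf_intersecting_sub_disjoint_le τ hτ G
  have hcard : Real.log (Fintype.card (Fin (B + 1) → Option Bool)) = (B + 1) * Real.log 3 := by
    simp [Real.log_pow]
  rw [hcard] at h
  simpa only [hG] using h

instance (n : ℕ) : MeasureTheory.IsProbabilityMeasure (coinMeasure n) := by
  unfold coinMeasure
  infer_instance

/-- The randomized communication complexity of unique disjointness is linear. -/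
theorem RandProtocol.card_le_of_disjointness
    (inp : (ι → Bool) → (ι → Bool) → Fin n → X)
    (hinp : ∀ x y x' y' i, inp x y' i = inp x y i ∨ inp x y' i = inp x' y' i)
    (Γ : RandProtocol n X Bool) (B : ℕ) (hB : ∀ ω x y, (Γ.det ω).bits (inp x y) ≤ B)
    (h1 : ∀ x y, (∃ i, x i = true ∧ y i = true) →
      2 / 3 ≤ coinMeasure n {ω | (Γ.det ω).answer (inp x y) = true})
    (h0 : ∀ x y, (¬ ∃ i, x i = true ∧ y i = true) →
      2 / 3 ≤ coinMeasure n {ω | (Γ.det ω).answer (inp x y) = false}) :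
    (Fintype.card ι : ℝ) ≤ 576 * ((B + 1) * Real.log 3) := by
  set μ := coinMeasure n
  let g : (ι → Bool) → (ι → Bool) → Coins n → ℝ := fun x y ω =>
    if (Γ.det ω).answer (inp x y) = true then 1 else 0
  have hg : ∀ x y, g x y = Set.indicator {ω | (Γ.det ω).answer (inp x y) = true} 1 := by
    intro x y
    funext ω
    simp [g, Set.indicator_apply]
  have hint : ∀ x y, MeasureTheory.Integrable (g x y) μ := fun x y => by
    rw [hg]
    exact (MeasureTheory.integrable_const (1 : ℝ)).indicator (Γ.measurable_answer _ _)
  have hval : ∀ x y, ∫ ω, g x y ω ∂μ = μ.real {ω | (Γ.det ω).answer (inp x y) = true} := by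
    intro x y
    rw [hg, MeasureTheory.integral_indicator_one (Γ.measurable_answer _ _)]
  have hreal : ∀ s : Set (Coins n), 2 / 3 ≤ μ s → (2 / 3 : ℝ) ≤ μ.real s := by
    intro s hs
    have := ENNReal.toReal_mono (MeasureTheory.measure_ne_top μ s) hs
    simpa [MeasureTheory.Measure.real] using this
  have hlow : ∀ i z (q : (ι → Bool) × (ι → Bool)), (1 / 3 : ℝ) ≤
      ∫ ω, (g (maskUpdate z q.1 i true) (maskUpdate (fun j => !z j) q.2 i true) ω -
        g (maskUpdate z q.1 i false) (maskUpdate (fun j => !z j) q.2 i false) ω) ∂μ := by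
    intro i z q
    rw [MeasureTheory.integral_sub (hint _ _) (hint _ _), hval, hval]
    have hA := hreal _ (h1 (maskUpdate z q.1 i true) (maskUpdate (fun j => !z j) q.2 i true)
      ⟨i, maskUpdate_self _ _ _ _, maskUpdate_self _ _ _ _⟩)
    have hB := hreal _ (h0 (maskUpdate z q.1 i false) (maskUpdate (fun j => !z j) q.2 i false) (by
      rintro ⟨j, hj⟩
      rcases eq_or_ne j i with rfl | hne
      · simp [maskUpdate_self] at hj
      · exact not_maskUpdate_and z q.1 q.2 i j hne _ _ hj))
    have hcompl := MeasureTheory.probReal_compl_eq_one_sub (μ := μ) (Γ.measurable_answer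
      (inp (maskUpdate z q.1 i false) (maskUpdate (fun j => !z j) q.2 i false)) true)
    have hset : {ω | (Γ.det ω).answer (inp (maskUpdate z q.1 i false)
        (maskUpdate (fun j => !z j) q.2 i false)) = true}ᶜ =
        {ω | (Γ.det ω).answer (inp (maskUpdate z q.1 i false)
        (maskUpdate (fun j => !z j) q.2 i false)) = false} := by
      ext ω
      simp
    rw [hset] at hcompl
    linarith
  have hsub : ∀ i z (q : (ι → Bool) × (ι → Bool)), MeasureTheory.Integrable (fun ω =>
    g (maskUpdate z q.1 i true) (maskUpdate (fun j => !z j) q.2 i true) ω -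
      g (maskUpdate z q.1 i false) (maskUpdate (fun j => !z j) q.2 i false) ω) μ :=
    fun i z q => (hint _ _).sub (hint _ _)
  -- The deterministic bound holds for every outcome of the coins, hence on average.
  have hup : ∫ ω, ∑ i, ∑ z, ∑ q : (ι → Bool) × (ι → Bool),
      (g (maskUpdate z q.1 i true) (maskUpdate (fun j => !z j) q.2 i true) ω -
        g (maskUpdate z q.1 i false) (maskUpdate (fun j => !z j) q.2 i false) ω) ∂μ ≤
      (2 ^ Fintype.card ι) ^ 3 * (Fintype.card ι / 6 + 96 * ((B + 1) * Real.log 3)) := by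
    refine (MeasureTheory.integral_mono (MeasureTheory.integrable_finsetSum _ fun i _ =>
      MeasureTheory.integrable_finsetSum _ fun z _ =>
        MeasureTheory.integrable_finsetSum _ fun q _ => hsub i z q)
      (MeasureTheory.integrable_const _)
      fun ω => (Γ.det ω).sum_answer_intersecting_sub_disjoint_le inp hinp B (hB ω)).trans ?_
    simp
  rw [MeasureTheory.integral_finsetSum _ fun i _ => MeasureTheory.integrable_finsetSum _
    fun z _ => MeasureTheory.integrable_finsetSum _ fun q _ => hsub i z q] at hup
  simp_rw [fun i => MeasureTheory.integral_finsetSum Finset.univ fun z _ =>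
      MeasureTheory.integrable_finsetSum Finset.univ fun q _ => hsub i z q,
    fun i z => MeasureTheory.integral_finsetSum Finset.univ fun q _ => hsub i z q] at hup
  have hsum := (Finset.sum_le_sum fun i (_ : i ∈ Finset.univ) =>
    Finset.sum_le_sum fun z (_ : z ∈ Finset.univ) =>
      Finset.sum_le_sum fun q (_ : q ∈ Finset.univ) => hlow i z q).trans hup
  simp only [Finset.sum_const, Finset.card_univ, Fintype.card_prod, Fintype.card_fun,
    Fintype.card_bool, nsmul_eq_mul, Nat.cast_mul, Nat.cast_pow, Nat.cast_ofNat] at hsum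
  have hW : (0 : ℝ) < (2 ^ Fintype.card ι) ^ 3 := by positivity
  have h2 : (2 ^ Fintype.card ι : ℝ) ^ 3 * (Fintype.card ι / 3) ≤
      (2 ^ Fintype.card ι) ^ 3 * (Fintype.card ι / 6 + 96 * ((B + 1) * Real.log 3)) := by
    refine le_trans (le_of_eq ?_) hsum
    ring
  have h3 := le_of_mul_le_mul_left h2 hW
  linarith

end ProtocolBound

/-! ### The reduction from unique disjointness -/

section Reduction

variable {n m k : ℕ}

/-- The coordinates of the disjointness problem: half of the first `2 * k` items. -/
abbrev HalfBundle (m k : ℕ) : Type :=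
  {S : Finset (Fin m) // S ∈ (lowItems m (2 * k)).powersetCard k}

theorem card_halfBundle (hm : 2 * k ≤ m) : Fintype.card (HalfBundle m k) = (2 * k).choose k := by
  rw [Fintype.card_coe, Finset.card_powersetCard, card_lowItems hm]

/-- The bundles of which the characteristic vector is `x`. -/
def Favoured (x : HalfBundle m k → Bool) (S : Finset (Fin m)) : Prop :=
  ∃ h, x ⟨S, h⟩ = true

open Classical in
/-- The first two players have hard valuations encoding `x` and, after complementation, `y`; every
other player only wants an item of her own. -/
def hardProfile (V : ℝ) (hk : 0 < k) (hm : 2 * k < m) (hV : 2 * k ≤ V) (hV0 : 0 < V)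
    (g : Fin n → Fin m) (x y : HalfBundle m k → Bool) (i : Fin n) : Valuation m :=
  if (i : ℕ) = 0 then hardValuation k (Favoured x) V hk hm hV
  else if (i : ℕ) = 1 then
    hardValuation k (fun S => Favoured y (lowItems m (2 * k) \ S)) V hk hm hV
  else singleItemValuation (g i) V hV0

theorem hardValuation_univ (F : Finset (Fin m) → Prop) [DecidablePred F] (V : ℝ)
    (hk : 0 < k) (hm : 2 * k < m) (hV : 2 * k ≤ V) :
    (hardValuation k F V hk hm hV).val Finset.univ = V := by
  have h : ¬ Finset.univ ⊆ lowItems m (2 * k) := fun h =>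
    absurd (mem_lowItems.1 (h (Finset.mem_univ (⟨2 * k, hm⟩ : Fin m)))) (by simp)
  simp only [hardValuation, if_neg h]

theorem le_cappedVal_iff (F : Finset (Fin m) → Prop) [DecidablePred F] (S : Finset (Fin m)) :
    2 * (k : ℝ) ≤ cappedVal k F S ↔ k < S.card ∨ S.card = k ∧ F S := by
  rcases lt_trichotomy S.card k with h | h | h
  · rw [cappedVal_of_lt h]
    have : (S.card : ℝ) < k := by exact_mod_cast h
    constructor
    · intro h'
      linarith
    · rintro (h' | h') <;> omega
  · by_cases hF : F S
    · simp [cappedVal_of_favoured h hF, h, hF]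
    · simp [cappedVal_of_not_favoured h hF, h, hF]
  · simp [cappedVal_of_gt h, h]

theorem mem_bundle {A : Allocation n m} {i : Fin n} {g : Fin m} : g ∈ A.bundle i ↔ A g = i := by
  simp [Allocation.bundle]

theorem le_singleItemValuation_iff (g : Fin m) (V : ℝ) (hV0 : 0 < V) (hk : 0 < k)
    (hV : 2 * (k : ℝ) ≤ V) (S : Finset (Fin m)) :
    2 * (k : ℝ) ≤ (singleItemValuation g V hV0).val S ↔ g ∈ S := by
  have : (0 : ℝ) < k := by exact_mod_cast hk
  simp only [singleItemValuation]
  split_ifs with h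
  · simp [h, hV]
  · simp only [h, iff_false, not_le]
    linarith

theorem exists_isProp_hardProfile_iff (hn : 2 < n) (hmn : m + 2 = 2 * k + n) (c V : ℝ)
    (hk : 0 < k) (hm : 2 * k < m) (hV : 2 * k ≤ V) (hV0 : 0 < V) (hcV : c * (V / n) = 2 * k)
    (g : Fin n → Fin m) (hg : ∀ i, (g i : ℕ) = 2 * k + (i - 2)) (x y : HalfBundle m k → Bool) :
    (∃ A, IsProp c (hardProfile V hk hm hV hV0 g x y) A) ↔
      ∃ S, x S = true ∧ y S = true := by
  classical
  have huniv : ∀ i, (hardProfile V hk hm hV hV0 g x y i).val Finset.univ = V := by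
    intro i
    unfold hardProfile
    split_ifs
    · exact hardValuation_univ _ _ _ _ _
    · exact hardValuation_univ _ _ _ _ _
    · simp [singleItemValuation]
  have hprop : ∀ A, IsProp c (hardProfile V hk hm hV hV0 g x y) A ↔
      ∀ i, 2 * (k : ℝ) ≤ (hardProfile V hk hm hV hV0 g x y i).val (A.bundle i) := by
    intro A
    simp only [IsProp, huniv, hcV]
  simp only [hprop]
  let p0 : Fin n := ⟨0, by omega⟩
  let p1 : Fin n := ⟨1, by omega⟩
  constructor
  · rintro ⟨A, hA⟩
    have hsingle : ∀ i : Fin n, 2 ≤ (i : ℕ) → A (g i) = i := by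
      intro i hi
      have := hA i
      rw [hardProfile, if_neg (by omega), if_neg (by omega), le_singleItemValuation_iff _ _ _ hk hV,
        mem_bundle] at this
      exact this
    have hlow : ∀ i : Fin n, (i : ℕ) < 2 → A.bundle i ⊆ lowItems m (2 * k) := by
      intro i hi a ha
      rw [mem_bundle] at ha
      rw [mem_lowItems]
      by_contra h
      -- The player whose only desired item is `a`.
      let j : Fin n := ⟨a - 2 * k + 2, by omega⟩
      have hj : g j = a := Fin.ext (by rw [hg]; simp only [j]; omega)
      have := hsingle j (by simp [j])
      rw [hj, ha] at this
      rw [this] at hi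
      simp [j] at hi
    have h0 := hA p0
    have h1 := hA p1
    rw [hardProfile, if_pos rfl] at h0
    rw [hardProfile, if_neg (by simp [p1]), if_pos rfl] at h1
    simp only [hardValuation] at h0 h1
    rw [if_pos (hlow p0 (by simp [p0])), le_cappedVal_iff] at h0
    rw [if_pos (hlow p1 (by simp [p1])), le_cappedVal_iff] at h1
    have hdisj : Disjoint (A.bundle p0) (A.bundle p1) := by
      rw [Finset.disjoint_left]
      intro a ha hb
      rw [mem_bundle] at ha hb
      rw [ha] at hb
      simp [p0, p1] at hb
    have hunion : A.bundle p0 ∪ A.bundle p1 ⊆ lowItems m (2 * k) :=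
      Finset.union_subset (hlow p0 (by simp [p0])) (hlow p1 (by simp [p1]))
    have hcard := Finset.card_le_card hunion
    rw [Finset.card_union_of_disjoint hdisj, card_lowItems hm.le] at hcard
    -- Two disjoint bundles of at least k items each among 2k items leave no room for more than k.
    have hc0 : (A.bundle p0).card = k ∧ Favoured x (A.bundle p0) := by
      rcases h0 with h0 | h0
      · rcases h1 with h1 | h1 <;> omega
      · exact h0
    have hc1 : (A.bundle p1).card = k ∧ Favoured y (lowItems m (2 * k) \ A.bundle p1) := by
      rcases h1 with h1 | h1
      · omega
      · exact h1
    have heq : A.bundle p0 ∪ A.bundle p1 = lowItems m (2 * k) :=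
      Finset.eq_of_subset_of_card_le hunion (by
        rw [Finset.card_union_of_disjoint hdisj, card_lowItems hm.le]
        omega)
    have hsd : lowItems m (2 * k) \ A.bundle p1 = A.bundle p0 := by
      rw [← heq, Finset.union_sdiff_right, sdiff_eq_left.2 hdisj]
    rw [hsd] at hc1
    obtain ⟨-, hS, hx⟩ := hc0
    obtain ⟨-, _, hy⟩ := hc1
    exact ⟨⟨A.bundle p0, hS⟩, hx, hy⟩
  · rintro ⟨⟨S, hS⟩, hx, hy⟩
    obtain ⟨hSl, hSc⟩ := Finset.mem_powersetCard.1 hS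
    let A : Allocation n m := fun a =>
      if h : (a : ℕ) < 2 * k then (if a ∈ S then p0 else p1) else ⟨a - 2 * k + 2, by omega⟩
    have hA0 : A.bundle p0 = S := by
      ext a
      rw [mem_bundle]
      simp only [A]
      split_ifs with h1 h2
      · simp [h2]
      · simp [h2, p0, p1]
      · simp only [p0, Fin.mk.injEq]
        constructor
        · omega
        · intro h
          exact absurd (mem_lowItems.1 (hSl h)) h1
    have hA1 : A.bundle p1 = lowItems m (2 * k) \ S := by
      ext a
      rw [mem_bundle, Finset.mem_sdiff, mem_lowItems]
      simp only [A]
      split_ifs with h1 h2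
      · simp [h2, p0, p1]
      · simp [h1, h2]
      · simp only [p1, Fin.mk.injEq, h1, false_and, iff_false]
        omega
    refine ⟨A, fun i => ?_⟩
    unfold hardProfile
    split_ifs with hi0 hi1
    · obtain rfl : i = p0 := Fin.ext hi0
      simp only [hardValuation]
      rw [hA0, if_pos hSl, le_cappedVal_iff]
      exact Or.inr ⟨hSc, hS, hx⟩
    · obtain rfl : i = p1 := Fin.ext hi1
      simp only [hardValuation]
      rw [hA1, if_pos Finset.sdiff_subset, le_cappedVal_iff, Finset.sdiff_sdiff_eq_self hSl,
        Finset.card_sdiff_of_subset hSl, card_lowItems hm.le]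
      exact Or.inr ⟨by omega, hS, hy⟩
    · rw [le_singleItemValuation_iff _ _ _ hk hV, mem_bundle]
      simp only [A]
      rw [dif_neg (by rw [hg]; omega)]
      refine Fin.ext ?_
      simp only [hg]
      omega

end Reduction

/-! ### The lower bound with explicit constants -/

theorem exists_choose_le_randSubmodPropDecisionPublic {n k : ℕ} (hn : 2 < n) (hk : 1400 ≤ k)
    {c : ℝ} (hc0 : 0 < c) (hc1 : c ≤ 1) :
    ∃ (w : Fin n → Valuation (2 * k + n - 2)) (L : Finset ℝ), L.card ≤ 2 * k + n - 2 ∧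
      ((1 / 1400 : ℝ≥0) : ℝ≥0∞) * ((2 * k).choose k : ℝ≥0∞) ≤
        (RSubmodPropDecisionPublic n (2 * k + n - 2) c w L : ℝ≥0∞) := by
  classical
  obtain ⟨m, hm⟩ : ∃ m, m = 2 * k + n - 2 := ⟨_, rfl⟩
  rw [← hm]
  have hk0 : 0 < k := by omega
  have hkm : 2 * k < m := by omega
  have hkR : (0 : ℝ) < k := by exact_mod_cast hk0
  have hnR : (2 : ℝ) < n := by exact_mod_cast hn
  -- Normalizes the required share to 2k for all n and c; c ≤ 1 then gives V ≥ 2k.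
  set V : ℝ := 2 * k * n / c with hVdef
  have hcV : c * (V / n) = 2 * k := by
    rw [hVdef]
    field_simp
  have hV : 2 * (k : ℝ) ≤ V := by
    rw [hVdef, le_div_iff₀ hc0]
    nlinarith
  have hV0 : 0 < V := by linarith
  -- Truncated subtraction gives the first two players the dummy value 2k, which `hardProfile` never
  -- reads.
  let g : Fin n → Fin m := fun i => ⟨2 * k + (i - 2), by omega⟩
  let w : Fin n → Valuation m := fun i => singleItemValuation (g i) V hV0
  refine ⟨w, hardValues k V, (card_hardValues_le k V).trans (by omega), ?_⟩
  let inp := hardProfile V hk0 hkm hV hV0 g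
  let D : Fin n → Set (Valuation m) := fun i =>
    {v | v.Submodular ∧ (∀ S, v.val S ∈ hardValues k V) ∧ (2 ≤ (i : ℕ) → v = w i)}
  have hD : ∀ x y i, inp x y i ∈ D i := by
    intro x y i
    simp only [inp, D, Set.mem_ofPred_eq, hardProfile]
    split_ifs with h1 h2
    · exact ⟨hardValuation_submodular _ _ _ _ _, hardValuation_val_mem _ _ _ _ _, by omega⟩
    · exact ⟨hardValuation_submodular _ _ _ _ _, hardValuation_val_mem _ _ _ _ _, by omega⟩
    · exact ⟨singleItemValuation_submodular _ _ _, singleItemValuation_val_mem _ _ _ hk0,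
        fun _ => rfl⟩
  have hmix : ∀ x y x' y' i, inp x y' i = inp x y i ∨ inp x y' i = inp x' y' i := by
    intro x y x' y' i
    simp only [inp, hardProfile]
    split_ifs
    · exact Or.inl rfl
    · exact Or.inr rfl
    · exact Or.inl rfl
  have hiff := exists_isProp_hardProfile_iff hn (by omega) c V hk0 hkm hV hV0 hcV g fun i => rfl
  have hN : Fintype.card (HalfBundle m k) = (2 * k).choose k := card_halfBundle hkm.le
  have hN2 : 2 * k ≤ (2 * k).choose k := by
    have := Nat.choose_le_centralBinom 1 k
    rwa [Nat.choose_one_right, Nat.centralBinom_eq_two_mul_choose] at this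
  have hcost : ∀ Γ : RandProtocol n (Valuation m) Bool, Γ.Correct D (PropDecision c) →
      ∀ B : ℕ, Γ.cost D ≤ B → (2 * k).choose k ≤ 1400 * B := by
    intro Γ hΓ B hB
    have h := Γ.card_le_of_disjointness inp hmix B
      (fun ω x y => by
        have h1 : ((Γ.det ω).bits (inp x y) : ℕ∞) ≤ Γ.cost D :=
          le_iSup_of_le (inp x y) (le_iSup_of_le (hD x y)
            (le_iSup (fun ω => ((Γ.det ω).bits (inp x y) : ℕ∞)) ω))
        exact_mod_cast h1.trans hB)
      (fun x y hxy => (hΓ _ (hD x y)).trans (le_of_eq (by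
        congr 1
        ext ω
        simp only [Set.mem_ofPred_eq, PropDecision, inp, hiff, hxy, iff_true])))
      (fun x y hxy => (hΓ _ (hD x y)).trans (le_of_eq (by
        congr 1
        ext ω
        simp only [Set.mem_ofPred_eq, PropDecision, inp, hiff, hxy, iff_false,
          Bool.not_eq_true])))
    rw [hN] at h
    have hlog : Real.log 3 ≤ 1.2 := by
      have h1 : Real.log 3 = Real.log 2 + Real.log (3 / 2) := by
        rw [← Real.log_mul (by norm_num) (by norm_num)]
        norm_num
      have h2 := Real.log_two_lt_d9
      have h3 := Real.log_le_sub_one_of_pos (show (0 : ℝ) < 3 / 2 by norm_num)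
      linarith
    have h2 : ((2 * k).choose k : ℝ) ≤ 700 * (B + 1) := by
      have : (0 : ℝ) ≤ B := B.cast_nonneg
      nlinarith
    have h3 : (2 * k).choose k ≤ 700 * (B + 1) := by exact_mod_cast h2
    -- Here 576 · 1.2 < 700. Since N ≥ 2k ≥ 2800, the case B = 0 is impossible, and for B ≥ 1 the
    -- bound 700(B + 1) is at most 1400B.
    omega
  -- No optimal protocol is needed: if the bound failed at B, every correct protocol would cost at
  -- least B + 1, and so would the infimum.
  have hcompl : ∀ B : ℕ, RSubmodPropDecisionPublic n m c w (hardValues k V) = B →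
      (2 * k).choose k ≤ 1400 * B := by
    intro B hB
    by_contra hlt
    have h1 : ((B + 1 : ℕ) : ℕ∞) ≤ RSubmodPropDecisionPublic n m c w (hardValues k V) := by
      refine le_iInf₂ fun Γ hΓ => ?_
      by_contra hΓB
      rw [not_le, Nat.cast_add, Nat.cast_one, ENat.lt_add_one_iff (ENat.natCast_ne_top B)] at hΓB
      exact hlt (hcost Γ hΓ B hΓB)
    rw [hB] at h1
    have : B + 1 ≤ B := by exact_mod_cast h1
    omega
  generalize RSubmodPropDecisionPublic n m c w (hardValues k V) = R at hcompl
  induction R using ENat.recTopCoe with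
  | top => simp
  | coe B =>
    have h := hcompl B rfl
    have h2 : (1 / 1400 : ℝ≥0) * ((2 * k).choose k : ℝ≥0) ≤ (B : ℝ≥0) := by
      have h3 : ((2 * k).choose k : ℝ≥0) ≤ 1400 * B := by exact_mod_cast h
      calc (1 / 1400 : ℝ≥0) * ((2 * k).choose k : ℝ≥0) ≤ 1 / 1400 * (1400 * B) := by gcongr
        _ = B := by field_simp
    rw [ENat.toENNReal_coe]
    exact_mod_cast ENNReal.coe_le_coe.2 h2

end FairDivision

end

theorem mainTheorem5 :
    ∃ C : ℝ≥0, 0 < C ∧ ∃ K : ℕ, ∀ (n : ℕ), 2 < n → ∀ (c : ℝ), 0 < c → c ≤ 1 → ∀ (k : ℕ), K ≤ k →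
      ((C : ℝ≥0∞) * ((2 * k).choose k : ℝ≥0∞) ≤
        (FairDivision.RSubmodPropDecision n (2 * k + n - 2) c : ℝ≥0∞)) ∧
      ((C : ℝ≥0∞) * ((2 * k).choose k : ℝ≥0∞) ≤
        (FairDivision.RSubmodProp n (2 * k + n - 2) c : ℝ≥0∞)) ∧
      (∃ (w : Fin n → FairDivision.Valuation (2 * k + n - 2)) (L : Finset ℝ),
        L.card ≤ 2 * k + n - 2 ∧
        (C : ℝ≥0∞) * ((2 * k).choose k : ℝ≥0∞) ≤
          (FairDivision.RSubmodPropDecisionPublic n (2 * k + n - 2) c w L : ℝ≥0∞)) := by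
  refine ⟨1 / 1400, by positivity, 1400, fun n hn c hc0 hc1 k hk => ?_⟩
  obtain ⟨w, L, hL, hle⟩ :=
    FairDivision.exists_choose_le_randSubmodPropDecisionPublic hn hk hc0 hc1
  have h1 : FairDivision.RSubmodPropDecisionPublic n (2 * k + n - 2) c w L ≤
      FairDivision.RSubmodPropDecision n (2 * k + n - 2) c :=
    FairDivision.randComplexity_mono (fun i v hv => hv.1) _
  have h2 : FairDivision.RSubmodPropDecision n (2 * k + n - 2) c ≤
      FairDivision.RSubmodProp n (2 * k + n - 2) c :=
    FairDivision.randComplexity_propDecision_le c _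
  have h3 := hle.trans (ENat.toENNReal_mono h1)
  exact ⟨h3, h3.trans (ENat.toENNReal_mono h2), w, L, hL, hle⟩
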